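/- **Conventions.** A \emph{restriction category} is a category $\mathcal C$ in which each map $f\colon A\to B$ is assigned a map $\bar f\colon A\to A$ such that $f\bar f=f$; $\bar f\bar g=\bar g\bar f$ and $\overline{g\bar f}=\bar g\bar f$ for $f\colon A\to B$, $g\colon A\to C$; and $\bar g f=f\,\overline{gf}$ for $f\colon A\to B$, $g\colon B\to C$. A map $f$ is \emph{total} if $\bar f=1$; $\mathcal O(A)$ is the set of restriction idempotents $e=\bar e\colon A\to A$. For parallel maps, $f\leqslant g$ means $f=g\bar f$, and $f,g$ are \emph{compatible} if $f\bar g=g\bar f$. $\mathcal C$ is a \emph{join restriction category} if every pairwise compatible family of parallel maps has a join for $\leqslant$, and $(\bigvee_i f_i)g=\bigvee_i(f_ig)$. A \emph{partial isomorphism} is a map $s$ with a partial inverse $s^*$, i.e. $s^*s=\bar s$, $ss^*=\overline{s^*}$; $\mathrm{PIso}(\mathcal C)$ is the restriction category of all objects of $\mathcal C$ and all partial isomorphisms. A \emph{local homeomorphism} is a total map that is a join of partial isomorphisms; $\mathrm{Lh}(\mathcal C)$ is the category of all objects of $\mathcal C$ and all local homeomorphisms. A \emph{local atlas} on $X$ is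 a family $(\varphi_{ij}\in\mathcal O(X))_{i,j\in I}$, $I$ a set, with $\varphi_{ij}=\varphi_{ji}$ and $\varphi_{jk}\varphi_{ij}\leqslant\varphi_{ik}$; a \emph{glueing} of it is a total map $p=\bigvee_{i\in I} p_i\colon E\to X$, with each $p_i$ a partial isomorphism with partial inverse $s_i$, such that $\varphi_{ij}=p_js_i$. $\mathcal C$ \emph{has local glueings} if every local atlas on every object has a glueing. A \emph{partite internal category} in $\mathcal C$ with objects of objects $A_i$ ($i\in I$) comprises objects of arrows $A_{ij}$ with total maps $\sigma_{ij}\colon A_{ij}\to A_i$ and $\tau_{ij}\colon A_{ij}\to A_j$, where $\sigma_{ij}$ has pullbacks along all total maps, identities $\eta_i\colon A_i\to A_{ii}$ and compositions $\mu_{ijk}\colon A_{jk}\times_{A_j}A_{ij}\to A_{ik}$, compatible with source and target and satisfying the usual unit and associativity laws. It is a \emph{partite internal groupoid} if there are maps $\iota_{ij}\colon A_{ij}\to A_{ji}$ with $\iota_{ji}\iota_{ij}=1$, $\sigma_{ji}\iota_{ij}=\tau_{ij}$ and $\mu_{iji}(\iota_{ij},1)=\eta_i\sigma_{ij}$. Let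 $\mathcal C$ be a join restriction category with local glueings (locally small, $I$ above being a set of the same size as the hom-sets). For partial isomorphisms $f,g\colon A\to B$ let $[\![f=g]\!]=\bigvee\{e\in\mathcal O(A): e\leqslant\bar f\bar g,\ fe=ge\}$. The \emph{Haefliger groupoid} $\Pi(\mathcal C)$ is the partite internal groupoid in $\mathcal C$ indexed by the objects of $\mathcal C$, with object of objects $A$ at $A$, such that: $\sigma_{AB}\colon\Pi(\mathcal C)_{AB}\to A$ is a glueing of the local atlas $([\![f=g]\!])_{f,g\in\mathrm{PIso}(\mathcal C)(A,B)}$, with sections $s_f\colon A\to\Pi(\mathcal C)_{AB}$; $\tau_{AB}s_f=f$; $\eta_A=s_{1_A}$; and $\mu_{ABC}\circ\tau_{AB}^*(s_g)\circ s_f=s_{gf}$, where $\tau_{AB}^*(s_g)=(s_g\tau_{AB},\overline{s_g\tau_{AB}})$ is the pullback of the partial section $s_g$ of $\sigma_{BC}$ along $\tau_{AB}$. **Proposition.** Let $\mathcal C$ be a join restriction category with local glueings. Then the Haefliger groupoid $\Pi(\mathcal C)$ exists and, however the glueings and fibre products are chosen, for all objects $A,B$ of $\mathcal C$ the maps $\sigma_{AB}$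 and $\tau_{AB}$ are local homeomorphisms, and the source–target span $$A\xleftarrow{\ \sigma_{AB}\ }\Pi(\mathcal C)_{AB}\xrightarrow{\ \tau_{AB}\ }B$$ exhibits $\Pi(\mathcal C)_{AB}$ as a product of $A$ and $B$ in the category $\mathrm{Lh}(\mathcal C)$ of local homeomorphisms between objects of $\mathcal C$. -/

import Mathlib

open CategoryTheory CategoryTheory.Limits

/-! Composites are written in diagrammatic order: `f ≫ g` is "first `f`, then `g`". -/

universe w v u u'

/-- A restriction category: every `f : A ⟶ B` has a restriction `restr f : A ⟶ A`
(the partial identity on the domain of definition of `f`), subject to four axioms. -/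
class RestrictionCategory (C : Type u) [Category.{v} C] where
  restr : ∀ {A B : C}, (A ⟶ B) → (A ⟶ A)
  restr_comp : ∀ {A B : C} (f : A ⟶ B), restr f ≫ f = f
  restr_comm : ∀ {A B B' : C} (f : A ⟶ B) (g : A ⟶ B'),
    restr f ≫ restr g = restr g ≫ restr f
  restr_restr_comp : ∀ {A B B' : C} (f : A ⟶ B) (g : A ⟶ B'),
    restr (restr f ≫ g) = restr f ≫ restr g
  comp_restr : ∀ {A B D : C} (f : A ⟶ B) (g : B ⟶ D),
    f ≫ restr g = restr (f ≫ g) ≫ f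

namespace RestrictionCategory

section Basic

variable {C : Type u} [Category.{v} C] [RestrictionCategory C]

/-- A restriction idempotent; these maps form `𝒪(A)`. -/
def IsRestrIdem {A : C} (e : A ⟶ A) : Prop := restr e = e

/-- A total map. -/
def IsTotal {A B : C} (f : A ⟶ B) : Prop := restr f = 𝟙 A

/-- The canonical partial order on a hom-set. -/
def HomLE {A B : C} (f g : A ⟶ B) : Prop := f = restr f ≫ g

/-- The compatibility relation on a hom-set. -/
def Compat {A B : C} (f g : A ⟶ B) : Prop := restr g ≫ f = restr f ≫ g

/-- A pairwise compatible set of parallel maps. -/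
def PairwiseCompat {A B : C} (S : Set (A ⟶ B)) : Prop :=
  ∀ f ∈ S, ∀ g ∈ S, Compat f g

/-- `h` is the join (least upper bound) of `S` for the canonical partial order. -/
def IsJoin {A B : C} (S : Set (A ⟶ B)) (h : A ⟶ B) : Prop :=
  (∀ f ∈ S, HomLE f h) ∧ ∀ k : A ⟶ B, (∀ f ∈ S, HomLE f k) → HomLE h k

/-- `t` is a partial inverse of `s`. -/
def IsPartialInverse {A B : C} (s : A ⟶ B) (t : B ⟶ A) : Prop :=
  s ≫ t = restr s ∧ t ≫ s = restr t

/-- A partial isomorphism. -/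
def IsPartialIso {A B : C} (s : A ⟶ B) : Prop := ∃ t : B ⟶ A, IsPartialInverse s t

/-- `s` is a partial section of `p`. -/
def IsPartialSection {A X : C} (p : A ⟶ X) (s : X ⟶ A) : Prop := s ≫ p = restr s

/-- An étale map: a join of partial isomorphisms. -/
def IsEtale {A B : C} (f : A ⟶ B) : Prop :=
  ∃ S : Set (A ⟶ B), (∀ s ∈ S, IsPartialIso s) ∧ IsJoin S f

/-- A local homeomorphism: a total étale map. -/
def IsLocalHomeo {A B : C} (f : A ⟶ B) : Prop := IsTotal f ∧ IsEtale f

lemma restr_id (A : C) : restr (𝟙 A) = 𝟙 A := by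
  simpa using restr_comp (𝟙 A)

lemma restr_restr {A B : C} (f : A ⟶ B) : restr (restr f) = restr f := by
  have h := restr_restr_comp f (𝟙 A)
  simpa [restr_id] using h

lemma restr_idem {A B : C} (f : A ⟶ B) : restr f ≫ restr f = restr f := by
  rw [← restr_restr_comp, restr_comp]

lemma restr_comp_le {A B D : C} (f : A ⟶ B) (g : B ⟶ D) :
    restr (f ≫ g) ≫ restr f = restr (f ≫ g) := by
  rw [restr_comm, ← restr_restr_comp, ← Category.assoc, restr_comp]

lemma restr_comp_restr {A B D : C} (f : A ⟶ B) (g : B ⟶ D) :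
    restr (f ≫ restr g) = restr (f ≫ g) := by
  rw [comp_restr, restr_restr_comp, restr_comp_le]

lemma HomLE.refl {A B : C} (f : A ⟶ B) : HomLE f f := (restr_comp f).symm

lemma HomLE.restr_eq {A B : C} {f g : A ⟶ B} (h : HomLE f g) :
    restr f ≫ restr g = restr f := by
  rw [← restr_restr_comp, ← show f = restr f ≫ g from h]

lemma HomLE.of_restr_comp {A B D : C} (e : A ⟶ D) (g : A ⟶ B) : HomLE (restr e ≫ g) g := by
  unfold HomLE
  rw [restr_restr_comp, Category.assoc, restr_comp]

lemma HomLE.trans {A B : C} {f g h : A ⟶ B} (h₁ : HomLE f g) (h₂ : HomLE g h) : HomLE f h := by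
  unfold HomLE
  calc f = restr f ≫ g := h₁
    _ = restr f ≫ restr g ≫ h := by rw [← show g = restr g ≫ h from h₂]
    _ = restr f ≫ h := by rw [← Category.assoc, h₁.restr_eq]

lemma HomLE.antisymm {A B : C} {f g : A ⟶ B} (h₁ : HomLE f g) (h₂ : HomLE g f) : f = g := by
  have h₃ : f = restr f ≫ g := h₁
  have h₄ : g = restr g ≫ f := h₂
  have e : restr f = restr g := by
    rw [← h₁.restr_eq, restr_comm, h₂.restr_eq]
  rw [h₃, e, restr_comp]

lemma HomLE.comp {A B D : C} {f f' : A ⟶ B} {g g' : B ⟶ D} (h : HomLE f f') (h' : HomLE g g') :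
    HomLE (f ≫ g) (f' ≫ g') := by
  have h₁ : f ≫ g = restr f ≫ f' ≫ restr g ≫ g' := by
    conv_lhs => rw [show f = restr f ≫ f' from h, show g = restr g ≫ g' from h']
    simp
  have h₂ : f ≫ g = restr (restr f ≫ restr (f' ≫ g)) ≫ f' ≫ g' := by
    rw [h₁, restr_restr_comp, restr_restr, ← Category.assoc f', comp_restr]
    simp
  rw [h₂]
  exact HomLE.of_restr_comp _ _

/-- A set of maps with an upper bound is pairwise compatible. -/
lemma PairwiseCompat.of_le {A B : C} {S : Set (A ⟶ B)} {h : A ⟶ B} (hS : ∀ f ∈ S, HomLE f h) :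
    PairwiseCompat S := by
  intro f hf g hg
  unfold Compat
  conv_lhs => rw [show f = restr f ≫ h from hS f hf]
  conv_rhs => rw [show g = restr g ≫ h from hS g hg]
  rw [← Category.assoc, ← Category.assoc, restr_comm]

lemma IsPartialInverse.symm {A B : C} {s : A ⟶ B} {t : B ⟶ A} (h : IsPartialInverse s t) :
    IsPartialInverse t s := ⟨h.2, h.1⟩

lemma isPartialIso_restr {A B : C} (f : A ⟶ B) : IsPartialIso (restr f) :=
  ⟨restr f, by rw [restr_restr, restr_idem], by rw [restr_restr, restr_idem]⟩

lemma isPartialIso_id (A : C) : IsPartialIso (𝟙 A) :=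
  ⟨𝟙 A, by simp [restr_id], by simp [restr_id]⟩

lemma IsPartialInverse.comp_aux {A B D : C} {s : A ⟶ B} {s' : B ⟶ A} {t : B ⟶ D} {t' : D ⟶ B}
    (hs : IsPartialInverse s s') (ht : IsPartialInverse t t') :
    (s ≫ t) ≫ (t' ≫ s') = restr (s ≫ t) := by
  calc (s ≫ t) ≫ (t' ≫ s') = s ≫ (t ≫ t') ≫ s' := by simp
    _ = (s ≫ restr t) ≫ s' := by rw [ht.1, Category.assoc]
    _ = restr (s ≫ t) ≫ restr s := by rw [comp_restr, Category.assoc, hs.1]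
    _ = restr (s ≫ t) := restr_comp_le s t

lemma IsPartialInverse.comp {A B D : C} {s : A ⟶ B} {s' : B ⟶ A} {t : B ⟶ D} {t' : D ⟶ B}
    (hs : IsPartialInverse s s') (ht : IsPartialInverse t t') :
    IsPartialInverse (s ≫ t) (t' ≫ s') :=
  ⟨hs.comp_aux ht, ht.symm.comp_aux hs.symm⟩

lemma IsPartialIso.comp {A B D : C} {s : A ⟶ B} {t : B ⟶ D}
    (hs : IsPartialIso s) (ht : IsPartialIso t) : IsPartialIso (s ≫ t) := by
  obtain ⟨s', hs⟩ := hs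
  obtain ⟨t', ht⟩ := ht
  exact ⟨t' ≫ s', hs.comp ht⟩

lemma IsTotal.comp {A B D : C} {f : A ⟶ B} {g : B ⟶ D} (hf : IsTotal f) (hg : IsTotal g) :
    IsTotal (f ≫ g) := by
  unfold IsTotal at *
  rw [← restr_comp_restr, hg, Category.comp_id, hf]

/-- The pullback of a partial section `s` of `p` along `f`: the map `Y ⟶ P` into the pullback
with components `f ≫ s` and `restr (f ≫ s)`. -/
noncomputable def pullbackSection {P A Y X : C} {π₁ : P ⟶ A} {π₂ : P ⟶ Y} {p : A ⟶ X} {f : Y ⟶ X}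
    (hP : IsPullback π₁ π₂ p f) (s : X ⟶ A) (hs : IsPartialSection p s) : Y ⟶ P :=
  hP.lift (f ≫ s) (restr (f ≫ s)) (by
    rw [Category.assoc, show s ≫ p = restr s from hs, comp_restr])

variable (C) in
/-- The class of partial isomorphisms of `C`. -/
def partialIsos : MorphismProperty C := fun _ _ f => IsPartialIso f

instance : (partialIsos C).IsMultiplicative where
  id_mem A := isPartialIso_id A
  comp_mem _ _ hf hg := IsPartialIso.comp hf hg

variable (C) in
/-- `PIso(C)`: all objects of `C`, and the partial isomorphisms between them. -/
abbrev PIso := WideSubcategory (partialIsos C)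

/-- `PIso(C)` has the restriction structure inherited from `C`. -/
instance : RestrictionCategory (PIso C) where
  restr f := ⟨restr f.hom, isPartialIso_restr f.hom⟩
  restr_comp f := WideSubcategory.hom_ext _ (restr_comp f.hom)
  restr_comm f g := WideSubcategory.hom_ext _ (restr_comm f.hom g.hom)
  restr_restr_comp f g := WideSubcategory.hom_ext _ (restr_restr_comp f.hom g.hom)
  comp_restr f g := WideSubcategory.hom_ext _ (comp_restr f.hom g.hom)

/-- A restriction functor. -/
class IsRestrictionFunctor {𝒜 : Type u'} [Category.{w} 𝒜] [RestrictionCategory 𝒜]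
    (P : 𝒜 ⥤ C) : Prop where
  map_restr : ∀ {i j : 𝒜} (f : i ⟶ j), P.map (restr f) = restr (P.map f)

variable (C) in
/-- The inclusion `PIso(C) ⥤ C`. -/
abbrev pisoInclusion : PIso C ⥤ C := wideSubcategoryInclusion (partialIsos C)

instance : IsRestrictionFunctor (pisoInclusion C) where
  map_restr _ := rfl

end Basic

end RestrictionCategory

open RestrictionCategory

/-- A join restriction category: compatible families of parallel maps have joins, which are
preserved by precomposition. -/
class JoinRestrictionCategory (C : Type u) [Category.{v} C] extends RestrictionCategory C where
  exists_isJoin : ∀ {A B : C} (S : Set (A ⟶ B)), PairwiseCompat S → ∃ h, IsJoin S h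
  isJoin_comp : ∀ {A' A B : C} (g : A' ⟶ A) (S : Set (A ⟶ B)) (h : A ⟶ B),
    PairwiseCompat S → IsJoin S h → IsJoin ((fun f => g ≫ f) '' S) (g ≫ h)

namespace JoinRestrictionCategory

section Basic

variable {C : Type u} [Category.{v} C] [JoinRestrictionCategory C]

/-- The join of a pairwise compatible set of parallel maps. -/
noncomputable def join {A B : C} (S : Set (A ⟶ B)) (hS : PairwiseCompat S) : A ⟶ B :=
  Classical.choose (exists_isJoin S hS)

lemma join_isJoin {A B : C} (S : Set (A ⟶ B)) (hS : PairwiseCompat S) : IsJoin S (join S hS) :=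
  Classical.choose_spec (exists_isJoin S hS)

lemma pairwiseCompat_restr {A B : C} (S : Set (A ⟶ B)) :
    PairwiseCompat ((fun f => restr f) '' S) :=
  PairwiseCompat.of_le (h := 𝟙 A) (by
    rintro _ ⟨f, -, rfl⟩
    simp [HomLE, restr_restr])

/-- The restriction of a join is the join of the restrictions. -/
lemma isJoin_restr {A B : C} {S : Set (A ⟶ B)} {p : A ⟶ B} (h : IsJoin S p) :
    IsJoin ((fun f => restr f) '' S) (restr p) := by
  have hE := join_isJoin _ (pairwiseCompat_restr S)
  set E := join _ (pairwiseCompat_restr S)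
  have hres : ∀ f ∈ S, HomLE (restr f) (restr p) := by
    intro f hf
    unfold HomLE
    rw [restr_restr, (h.1 f hf).restr_eq]
  have hEp : HomLE E (restr p) := hE.2 _ (by rintro _ ⟨f, hf, rfl⟩; exact hres f hf)
  have hE1 : E = restr E := by
    have : HomLE E (𝟙 A) := hE.2 _ (by rintro _ ⟨f, -, rfl⟩; simp [HomLE, restr_restr])
    simpa [HomLE] using this
  have hpE : HomLE p (E ≫ p) := by
    refine h.2 _ fun f hf => ?_
    have h₁ : HomLE (restr f) E := hE.1 _ ⟨f, hf, rfl⟩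
    have := h₁.comp (h.1 f hf)
    rwa [restr_comp] at this
  have hEp' : HomLE (restr p) E := by
    have h₁ : HomLE (E ≫ p) p := by
      rw [hE1]; exact HomLE.of_restr_comp _ _
    have h₂ : E ≫ p = p := h₁.antisymm hpE
    have h₃ : E ≫ restr p = restr p := by
      conv_lhs => rw [hE1, ← restr_restr_comp, ← hE1, h₂]
    unfold HomLE
    rw [restr_restr]
    conv_rhs => rw [hE1, restr_comm, ← hE1, h₃]
  rw [← hEp.antisymm hEp']
  exact hE

/-- Joins are preserved by postcomposition. -/
lemma isJoin_postcomp {A B D : C} {S : Set (A ⟶ B)} {p : A ⟶ B} (h : IsJoin S p) (g : B ⟶ D) :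
    IsJoin ((fun f => f ≫ g) '' S) (p ≫ g) := by
  refine ⟨?_, fun k hk => ?_⟩
  · rintro _ ⟨f, hf, rfl⟩
    exact (h.1 f hf).comp (HomLE.refl g)
  · have hJ := isJoin_comp (restr (p ≫ g)) _ _ (pairwiseCompat_restr S) (isJoin_restr h)
    rw [restr_comp_le] at hJ
    have key : HomLE (restr (p ≫ g)) (restr (restr (p ≫ g) ≫ restr k)) := by
      refine hJ.2 _ ?_
      rintro _ ⟨_, ⟨f, hf, rfl⟩, rfl⟩
      have h₁ : restr (p ≫ g) ≫ restr f = restr (f ≫ g) := by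
        rw [restr_comm, ← restr_restr_comp, ← Category.assoc,
          ← show f = restr f ≫ p from h.1 f hf]
      have hfk := hk _ ⟨f, hf, rfl⟩
      have hle : HomLE (f ≫ g) (p ≫ g) := (h.1 f hf).comp (HomLE.refl g)
      change HomLE (restr (p ≫ g) ≫ restr f) _
      rw [h₁]
      unfold HomLE
      rw [restr_restr, restr_restr_comp, restr_restr, ← Category.assoc, hle.restr_eq,
        hfk.restr_eq]
    -- the maps `p ≫ g` and `k` agree on each piece
    have hJ' := isJoin_comp (restr (p ≫ g)) _ _ (pairwiseCompat_restr S) (isJoin_restr h)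
    have hq : PairwiseCompat ((fun f => f ≫ g) '' S) := PairwiseCompat.of_le hk
    obtain ⟨q, hq⟩ := exists_isJoin _ hq
    have hqk : HomLE q k := hq.2 _ hk
    have hqp : HomLE q (p ≫ g) := hq.2 _ (by
      rintro _ ⟨f, hf, rfl⟩
      exact (h.1 f hf).comp (HomLE.refl g))
    have hpq : HomLE (restr (p ≫ g)) (restr q) := by
      refine hJ.2 _ ?_
      rintro _ ⟨_, ⟨f, hf, rfl⟩, rfl⟩
      have h₁ : restr (p ≫ g) ≫ restr f = restr (f ≫ g) := by
        rw [restr_comm, ← restr_restr_comp, ← Category.assoc,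
          ← show f = restr f ≫ p from h.1 f hf]
      have hfq := hq.1 _ ⟨f, hf, rfl⟩
      change HomLE (restr (p ≫ g) ≫ restr f) _
      rw [h₁]
      unfold HomLE
      rw [restr_restr, hfq.restr_eq]
    have : restr (p ≫ g) = restr q := by
      have h₁ : restr (p ≫ g) = restr (p ≫ g) ≫ restr q := by
        simpa [HomLE, restr_restr] using hpq
      rw [h₁, restr_comm, hqp.restr_eq]
    have hpq' : p ≫ g = q := by
      rw [show q = restr q ≫ p ≫ g from hqp, ← this, restr_comp]
    rw [hpq']
    exact hqk

lemma isLocalHomeo_id (A : C) : IsLocalHomeo (𝟙 A) :=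
  ⟨restr_id A, {𝟙 A}, by rintro _ rfl; exact isPartialIso_id A,
    by rintro _ rfl; exact HomLE.refl _, fun _ hk => hk _ rfl⟩

lemma IsLocalHomeo.comp {A B D : C} {f : A ⟶ B} {g : B ⟶ D}
    (hf : IsLocalHomeo f) (hg : IsLocalHomeo g) : IsLocalHomeo (f ≫ g) := by
  obtain ⟨hft, S, hS, hSf⟩ := hf
  obtain ⟨hgt, T, hT, hTg⟩ := hg
  refine ⟨hft.comp hgt, {k | ∃ s ∈ S, ∃ t ∈ T, k = s ≫ t}, ?_, ?_, fun k hk => ?_⟩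
  · rintro _ ⟨s, hs, t, ht, rfl⟩
    exact (hS s hs).comp (hT t ht)
  · rintro _ ⟨s, hs, t, ht, rfl⟩
    exact (hSf.1 s hs).comp (hTg.1 t ht)
  · refine (isJoin_comp f T g (PairwiseCompat.of_le hTg.1) hTg).2 k ?_
    rintro _ ⟨t, ht, rfl⟩
    refine (isJoin_postcomp hSf t).2 k ?_
    rintro _ ⟨s, hs, rfl⟩
    exact hk _ ⟨s, hs, t, ht, rfl⟩

variable (C) in
/-- The class of local homeomorphisms of `C`. -/
def localHomeos : MorphismProperty C := fun _ _ f => IsLocalHomeo f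

instance : (localHomeos C).IsMultiplicative where
  id_mem A := isLocalHomeo_id A
  comp_mem _ _ hf hg := IsLocalHomeo.comp hf hg

variable (C) in
/-- `Lh(C)`: all objects of `C`, and the local homeomorphisms between them. -/
abbrev Lh := WideSubcategory (localHomeos C)

/-- A local homeomorphism of `C`, as a morphism of `Lh(C)`. -/
def Lh.homMk {A B : C} (f : A ⟶ B) (hf : IsLocalHomeo f) :
    (⟨A⟩ : Lh C) ⟶ (⟨B⟩ : Lh C) :=
  ⟨f, hf⟩

/-- An `I`-indexed local atlas on `X`: a matrix of restriction idempotents with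
`φ_ij = φ_ji` and `φ_jk ∘ φ_ij ≤ φ_ik`. -/
structure IsLocalAtlas {X : C} {I : Type w} (φ : I → I → (X ⟶ X)) : Prop where
  isRestrIdem : ∀ i j, IsRestrIdem (φ i j)
  symm : ∀ i j, φ i j = φ j i
  trans : ∀ i j k, HomLE (φ i j ≫ φ j k) (φ i k)

/-- The data exhibiting `p : E ⟶ X` as a glueing of `φ`: a presentation of `p` as a total join of
partial isomorphisms `piece i : E ⟶ X`, with partial inverses `sec i : X ⟶ E`,
inducing `φ` in that `φ_ij = piece j ∘ sec i`. -/
structure Glueing {X E : C} {I : Type w} (φ : I → I → (X ⟶ X)) (p : E ⟶ X) where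
  piece : I → (E ⟶ X)
  sec : I → (X ⟶ E)
  isPartialInverse : ∀ i, IsPartialInverse (piece i) (sec i)
  isJoin : IsJoin (Set.range piece) p
  isTotal : IsTotal p
  sec_piece : ∀ i j, sec i ≫ piece j = φ i j

variable (C) in
/-- `C` has local glueings: every local atlas, indexed by any set, is induced by some local
homeomorphism. -/
class HasLocalGlueings : Prop where
  exists_glueing : ∀ (X : C) (I : Type v) (φ : I → I → (X ⟶ X)), IsLocalAtlas φ →
    ∃ (E : C) (p : E ⟶ X), Nonempty (Glueing φ p)

/-- The sections of a glueing are partial sections of the glued map. -/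
lemma Glueing.isPartialSection {X E : C} {I : Type w} {φ : I → I → (X ⟶ X)} {p : E ⟶ X}
    (G : Glueing φ p) (i : I) : IsPartialSection p (G.sec i) := by
  have hi := G.isPartialInverse i
  have h₁ : G.piece i = restr (G.piece i) ≫ p := G.isJoin.1 _ ⟨i, rfl⟩
  have h₂ : G.sec i ≫ restr (G.piece i) = G.sec i := by
    rw [← hi.1, ← Category.assoc, hi.2, restr_comp]
  unfold IsPartialSection
  rw [← h₂, Category.assoc, ← h₁, hi.2, h₂]

/-- An `I`-partite internal category with the given objects of objects `obj i`.  The object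
`pb i j k`, with its projections, is the fibre product of `src j k` and `tgt i j`.  The maps
`ident` and `comp` are automatically total, by their compatibility with `src`.  Associativity is
stated for generalised elements of the triple fibre product. -/
structure PartiteInternalCategory {I : Type w} (obj : I → C) where
  arr : I → I → C
  src : ∀ i j, arr i j ⟶ obj i
  tgt : ∀ i j, arr i j ⟶ obj j
  src_total : ∀ i j, IsTotal (src i j)
  tgt_total : ∀ i j, IsTotal (tgt i j)
  src_hasPullback : ∀ i j {X : C} (f : X ⟶ obj i), IsTotal f → HasPullback (src i j) f
  ident : ∀ i, obj i ⟶ arr i i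
  ident_src : ∀ i, ident i ≫ src i i = 𝟙 (obj i)
  ident_tgt : ∀ i, ident i ≫ tgt i i = 𝟙 (obj i)
  pb : I → I → I → C
  fst : ∀ i j k, pb i j k ⟶ arr j k
  snd : ∀ i j k, pb i j k ⟶ arr i j
  isPullback : ∀ i j k, IsPullback (fst i j k) (snd i j k) (src j k) (tgt i j)
  comp : ∀ i j k, pb i j k ⟶ arr i k
  comp_src : ∀ i j k, comp i j k ≫ src i k = snd i j k ≫ src i j
  comp_tgt : ∀ i j k, comp i j k ≫ tgt i k = fst i j k ≫ tgt j k
  comp_ident : ∀ i j,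
    (isPullback i i j).lift (𝟙 (arr i j)) (src i j ≫ ident i) (by simp [ident_tgt]) ≫
      comp i i j = 𝟙 (arr i j)
  ident_comp : ∀ i j,
    (isPullback i j j).lift (tgt i j ≫ ident j) (𝟙 (arr i j)) (by simp [ident_src]) ≫
      comp i j j = 𝟙 (arr i j)
  assoc : ∀ i j k l {T : C} (a : T ⟶ arr k l) (b : T ⟶ arr j k) (c : T ⟶ arr i j)
    (hab : a ≫ src k l = b ≫ tgt j k) (hbc : b ≫ src j k = c ≫ tgt i j),
    (isPullback i k l).lift a ((isPullback i j k).lift b c hbc ≫ comp i j k)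
        (by simp [comp_tgt, hab]) ≫ comp i k l =
      (isPullback i j l).lift ((isPullback j k l).lift a b hab ≫ comp j k l) c
        (by simp [comp_src, hbc]) ≫ comp i j l

/-- An `I`-partite internal groupoid: a partite internal category with inversion maps.  These are
automatically total, by their compatibility with `src` and `tgt`. -/
structure PartiteInternalGroupoid {I : Type w} (obj : I → C)
    extends PartiteInternalCategory obj where
  inv : ∀ i j, arr i j ⟶ arr j i
  inv_inv : ∀ i j, inv i j ≫ inv j i = 𝟙 (arr i j)
  inv_src : ∀ i j, inv i j ≫ src j i = tgt i j
  inv_comp : ∀ i j,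
    (isPullback i j i).lift (inv i j) (𝟙 (arr i j)) (by simp [inv_src]) ≫ comp i j i =
      src i j ≫ ident i

section Internalisation

variable {𝒜 : Type u'} [Category.{v} 𝒜] [RestrictionCategory 𝒜] (P : 𝒜 ⥤ C)
  [IsRestrictionFunctor P]

/-- The idempotents `P e` with `e ≤ f̄ ḡ` a restriction idempotent such that `f e = g e`. -/
def eqIdemSet {i j : 𝒜} (f g : i ⟶ j) : Set (P.obj i ⟶ P.obj i) :=
  {d | ∃ e : i ⟶ i, IsRestrIdem e ∧ HomLE e (restr f ≫ restr g) ∧ e ≫ f = e ≫ g ∧ d = P.map e}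

lemma eqIdemSet_compat {i j : 𝒜} (f g : i ⟶ j) : PairwiseCompat (eqIdemSet P f g) :=
  PairwiseCompat.of_le (h := 𝟙 (P.obj i)) (by
    rintro _ ⟨e, he, -, -, rfl⟩
    unfold HomLE
    rw [Category.comp_id, ← IsRestrictionFunctor.map_restr, show restr e = e from he])

/-- The equality `⟦f = g⟧ ∈ 𝒪(P i)` of parallel maps `f, g : i ⟶ j`, valued in restriction
idempotents: the join of all `P e` with `e ≤ f̄ ḡ` a restriction idempotent and `f e = g e`. -/
noncomputable def eqIdem {i j : 𝒜} (f g : i ⟶ j) : P.obj i ⟶ P.obj i :=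
  join (eqIdemSet P f g) (eqIdemSet_compat P f g)

/-- The data exhibiting a partite internal category as the internalisation `Ψ P` of the
restriction functor `P : 𝒜 ⥤ C`: its components are the objects of `𝒜`, its object of objects at
`i` is `P i`, its source maps are glueings of the local atlases `⟦f = g⟧`, and its target,
identity and composition maps are determined by their effect on the glueing sections `s_f`. -/
structure Internalisation (𝔸 : PartiteInternalCategory P.obj) where
  glue : ∀ i j : 𝒜, Glueing (fun f g : i ⟶ j => eqIdem P f g) (𝔸.src i j)
  sec_tgt : ∀ {i j : 𝒜} (f : i ⟶ j), (glue i j).sec f ≫ 𝔸.tgt i j = P.map f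
  ident_eq : ∀ i : 𝒜, 𝔸.ident i = (glue i i).sec (𝟙 i)
  comp_eq : ∀ {i j k : 𝒜} (f : i ⟶ j) (g : j ⟶ k),
    (glue i j).sec f ≫
        pullbackSection (𝔸.isPullback i j k) ((glue j k).sec g) ((glue j k).isPartialSection g) ≫
          𝔸.comp i j k =
      (glue i k).sec (f ≫ g)

end Internalisation

variable (C) in
/-- A Haefliger groupoid `Π(C)` of `C`: a partite internal groupoid in `C` which is the
internalisation of the inclusion `PIso(C) ⥤ C`.  It is determined up to the choice of glueings
and of fibre products. -/
structure HaefligerGroupoid extends PartiteInternalGroupoid (pisoInclusion C).obj where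
  internalisation : Internalisation (pisoInclusion C) toPartiteInternalCategory

namespace HaefligerGroupoid

/-- The object of arrows `Π(C)_AB`. -/
def arrows (H : HaefligerGroupoid C) (A B : C) : C := H.arr ⟨A⟩ ⟨B⟩

/-- The source map `σ_AB : Π(C)_AB ⟶ A`. -/
def source (H : HaefligerGroupoid C) (A B : C) : H.arrows A B ⟶ A := H.src ⟨A⟩ ⟨B⟩

/-- The target map `τ_AB : Π(C)_AB ⟶ B`. -/
def target (H : HaefligerGroupoid C) (A B : C) : H.arrows A B ⟶ B := H.tgt ⟨A⟩ ⟨B⟩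

end HaefligerGroupoid

end Basic

end JoinRestrictionCategory

open JoinRestrictionCategory

/-! The object `Π(C)_AB` consists of germs of partial isomorphisms from `A` to `B`: it has one sheet
over `A` for each partial isomorphism `f`, and the sheets of `f` and `g` are identified exactly
where `f` and `g` agree. The target map is `f` on the sheet of `f`, so it is a local homeomorphism
as well.

Uniqueness in the product property holds because étale maps are open. If `F i` and `F j` agree along
an étale map, they agree on an idempotent of `A` containing its image, so the two sheets coincide
there (`comp_sec_eq_of_comp_eq`). Hence a map into the object of germs with étale source component
is determined by its source and target (`eq_of_comp_source_eq_of_comp_target_eq`). Existence holds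
because a span `(a, b)` of local homeomorphisms is locally the graph of the partial isomorphism "`b`
after a local inverse of `a`". The germs of these partial isomorphisms glue to the required map
(`exists_comp_source_eq_comp_target_eq`).

The groupoid then comes almost for free. Fibre products are glueings of pulled-back atlases
(`Glueing.exists_isPullback`), composition and inversion are induced by spans of local
homeomorphisms, and each law equates two maps with the same source and target. -/

namespace RestrictionCategory

variable {C : Type u} [Category.{v} C] [RestrictionCategory C]

/-! ### Order, compatibility and totality -/

lemma IsJoin.unique {A B : C} {S : Set (A ⟶ B)} {f g : A ⟶ B} (hf : IsJoin S f)
    (hg : IsJoin S g) : f = g :=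
  (hf.2 g hg.1).antisymm (hg.2 f hf.1)

lemma HomLE.restr_comp_eq {A B : C} {f g : A ⟶ B} (h : HomLE f g) : restr f ≫ g = f := h.symm

lemma HomLE.restr_mono {A B : C} {f g : A ⟶ B} (h : HomLE f g) : HomLE (restr f) (restr g) := by
  unfold HomLE
  rw [restr_restr, h.restr_eq]

/-- A map below a restriction idempotent is a restriction idempotent. -/
lemma HomLE.restr_eq_self {A B : C} {d : A ⟶ A} {f : A ⟶ B} (h : HomLE d (restr f)) :
    restr d = d := by
  conv_lhs => rw [show d = _ from h]
  rw [restr_restr_comp, restr_restr]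
  exact h.symm

/-- The idempotents `restr a` and `restr b` may exceed the domains of `f` and `g`. The equation `h`
forces both maps to have the same domain inside their overlap, so cutting down by these idempotents
or by the true domains gives the same result. -/
lemma compat_of_restr_comp_eq {A B D D' : C} {f g : A ⟶ B} {a : A ⟶ D} {b : A ⟶ D'}
    (hf : restr a ≫ f = f) (hg : restr b ≫ g = g) (h : restr b ≫ f = restr a ≫ g) :
    Compat f g := by
  unfold Compat
  have h₁ : restr g ≫ f = restr a ≫ g := by
    calc restr g ≫ f = restr (restr b ≫ g) ≫ f := by rw [hg]
      _ = restr g ≫ restr b ≫ f := by rw [restr_restr_comp, restr_comm, Category.assoc]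
      _ = restr a ≫ restr g ≫ g := by
        rw [h, ← Category.assoc, restr_comm, Category.assoc]
      _ = restr a ≫ g := by rw [restr_comp]
  have h₂ : restr f ≫ g = restr b ≫ f := by
    calc restr f ≫ g = restr (restr a ≫ f) ≫ g := by rw [hf]
      _ = restr f ≫ restr a ≫ g := by rw [restr_restr_comp, restr_comm, Category.assoc]
      _ = restr b ≫ restr f ≫ f := by
        rw [← h, ← Category.assoc, restr_comm, Category.assoc]
      _ = restr b ≫ f := by rw [restr_comp]
  rw [h₁, h₂, h]

lemma isTotal_of_comp {A B D : C} {f : A ⟶ B} {g : B ⟶ D} (h : IsTotal (f ≫ g)) :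
    IsTotal f := by
  have := restr_comp_le f g
  unfold IsTotal at *
  rwa [h, Category.id_comp] at this

lemma IsTotal.restr_comp_eq {A B D : C} {g : B ⟶ D} (hg : IsTotal g) (f : A ⟶ B) :
    restr (f ≫ g) = restr f := by
  rw [← restr_comp_restr, show restr g = 𝟙 B from hg, Category.comp_id]

lemma IsPartialIso.isEtale {A B : C} {f : A ⟶ B} (hf : IsPartialIso f) : IsEtale f :=
  ⟨{f}, by rintro _ rfl; exact hf, by rintro _ rfl; exact HomLE.refl _, fun _ hk => hk _ rfl⟩

end RestrictionCategory

namespace JoinRestrictionCategory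

variable {C : Type u} [Category.{v} C] [JoinRestrictionCategory C]

/-! ### Joins of families and étale maps -/

lemma isJoin_range_comp {A' A B : C} {ι : Type*} (g : A' ⟶ A) {f : ι → (A ⟶ B)} {h : A ⟶ B}
    (hf : IsJoin (Set.range f) h) : IsJoin (Set.range fun i => g ≫ f i) (g ≫ h) := by
  have := isJoin_comp g _ _ (PairwiseCompat.of_le hf.1) hf
  rwa [← Set.range_comp] at this

lemma isJoin_range_postcomp {A B D : C} {ι : Type*} {f : ι → (A ⟶ B)} {h : A ⟶ B}
    (hf : IsJoin (Set.range f) h) (g : B ⟶ D) :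
    IsJoin (Set.range fun i => f i ≫ g) (h ≫ g) := by
  have := isJoin_postcomp hf g
  rwa [← Set.range_comp] at this

lemma isJoin_range_restr {A B : C} {ι : Type*} {f : ι → (A ⟶ B)} {h : A ⟶ B}
    (hf : IsJoin (Set.range f) h) : IsJoin (Set.range fun i => restr (f i)) (restr h) := by
  have := isJoin_restr hf
  rwa [← Set.range_comp] at this

/-- Common refinement of two covers: it puts two joins over one index set, so that they can be
compared term by term. -/
lemma isJoin_range_restr_comp₂ {A B D : C} {ι κ : Type*} {x : ι → (A ⟶ B)} {a : A ⟶ B}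
    {y : κ → (A ⟶ D)} {b : A ⟶ D} (hx : IsJoin (Set.range x) a) (hy : IsJoin (Set.range y) b) :
    IsJoin (Set.range fun k : ι × κ => restr (y k.2) ≫ x k.1) (restr b ≫ a) := by
  refine ⟨?_, fun k hk => ?_⟩
  · rintro _ ⟨⟨i, j⟩, rfl⟩
    exact (hy.1 _ ⟨j, rfl⟩).restr_mono.comp (hx.1 _ ⟨i, rfl⟩)
  · refine (isJoin_range_comp (restr b) hx).2 k ?_
    rintro _ ⟨i, rfl⟩
    refine (isJoin_range_postcomp (isJoin_range_restr hy) (x i)).2 k ?_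
    rintro _ ⟨j, rfl⟩
    exact hk _ ⟨(i, j), rfl⟩

lemma isJoin_range_restr_comp₂' {A B D : C} {ι κ : Type*} {x : ι → (A ⟶ B)} {a : A ⟶ B}
    {y : κ → (A ⟶ D)} {b : A ⟶ D} (hx : IsJoin (Set.range x) a) (hy : IsJoin (Set.range y) b) :
    IsJoin (Set.range fun k : κ × ι => restr (y k.1) ≫ x k.2) (restr b ≫ a) := by
  have := isJoin_range_restr_comp₂ hx hy
  rwa [← (Equiv.prodComm κ ι).surjective.range_comp] at this

lemma IsEtale.of_isJoin {A B : C} {S : Set (A ⟶ B)} {f : A ⟶ B} (hS : ∀ s ∈ S, IsEtale s)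
    (hf : IsJoin S f) : IsEtale f := by
  -- Using every partial isomorphism below `f` avoids choosing a cover for each member of `S`.
  refine ⟨{t | IsPartialIso t ∧ HomLE t f}, fun t ht => ht.1, fun t ht => ht.2, fun k hk => ?_⟩
  refine hf.2 k fun s hs => ?_
  obtain ⟨T, hT, hTs⟩ := hS s hs
  exact hTs.2 k fun t ht => hk t ⟨hT t ht, (hTs.1 t ht).trans (hf.1 s hs)⟩

lemma IsEtale.restr_comp {A B D : C} {f : A ⟶ B} (hf : IsEtale f) (e : A ⟶ D) :
    IsEtale (restr e ≫ f) := by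
  obtain ⟨S, hS, hSf⟩ := hf
  refine IsEtale.of_isJoin ?_ (isJoin_comp (restr e) S f (PairwiseCompat.of_le hSf.1) hSf)
  rintro _ ⟨s, hs, rfl⟩
  exact ((isPartialIso_restr e).comp (hS s hs)).isEtale

lemma IsEtale.comp_partialIso {A' A B B' : C} {f : A ⟶ B} (hf : IsEtale f) {s : A' ⟶ A}
    (hs : IsPartialIso s) {t : B ⟶ B'} (ht : IsPartialIso t) : IsEtale (s ≫ f ≫ t) := by
  obtain ⟨S, hS, hSf⟩ := hf
  have h₁ := isJoin_postcomp hSf t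
  refine IsEtale.of_isJoin ?_ (isJoin_comp s _ _ (PairwiseCompat.of_le h₁.1) h₁)
  rintro _ ⟨_, ⟨x, hx, rfl⟩, rfl⟩
  exact (hs.comp ((hS x hx).comp ht)).isEtale

/-! ### Sheets and sections of a glueing -/

namespace Glueing

variable {X E : C} {I : Type w} {φ : I → I → (X ⟶ X)} {p : E ⟶ X} (G : Glueing φ p)
include G

lemma piece_le (i : I) : HomLE (G.piece i) p := G.isJoin.1 _ ⟨i, rfl⟩

lemma piece_sec (i : I) : G.piece i ≫ G.sec i = restr (G.piece i) := (G.isPartialInverse i).1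

lemma restr_sec (i : I) : restr (G.sec i) = φ i i := by
  rw [← G.sec_piece, (G.isPartialInverse i).2]

lemma diag_comp_sec (i : I) : φ i i ≫ G.sec i = G.sec i := by
  rw [← G.restr_sec, restr_comp]

lemma sec_comp (i : I) : G.sec i ≫ p = φ i i := by
  rw [show _ = _ from G.isPartialSection i, G.restr_sec]

lemma restr_piece_comp (i : I) : restr (G.piece i) ≫ p = G.piece i :=
  (G.piece_le i).restr_comp_eq

lemma piece_comp_diag (i : I) : G.piece i ≫ φ i i = G.piece i := by
  rw [← G.sec_piece, ← Category.assoc, G.piece_sec, restr_comp]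

/-- A `Glueing` does not presuppose that `φ` is an atlas. Since `piece j` lies below `p`, the map `φ
i j` lies below `sec i ≫ p`, which is the idempotent `restr (sec i)`. -/
lemma restr_eq (i j : I) : restr (φ i j) = φ i j := by
  refine HomLE.restr_eq_self (f := G.sec i) ?_
  have := (HomLE.refl (G.sec i)).comp (G.piece_le j)
  rwa [G.sec_piece, G.sec_comp, ← G.restr_sec] at this

lemma comp_sec (i j : I) : φ i j ≫ G.sec i = φ i j ≫ G.sec j := by
  conv_rhs => rw [← G.sec_piece, Category.assoc, G.piece_sec, comp_restr,
    G.sec_piece, G.restr_eq]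

lemma restr_piece_comp_piece (i j : I) : restr (G.piece i) ≫ G.piece j = G.piece i ≫ φ i j := by
  rw [← G.piece_sec, Category.assoc, G.sec_piece]

lemma isJoin_restr_piece : IsJoin (Set.range fun i => restr (G.piece i)) (𝟙 E) := by
  have := isJoin_range_restr G.isJoin
  rwa [show restr p = _ from G.isTotal] at this

lemma isEtale : IsEtale p :=
  ⟨_, by rintro _ ⟨i, rfl⟩; exact ⟨_, G.isPartialInverse i⟩, G.isJoin⟩

lemma isLocalHomeo : IsLocalHomeo p := ⟨G.isTotal, G.isEtale⟩

lemma isJoin_comp_piece_sec {T : C} (h : T ⟶ E) :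
    IsJoin (Set.range fun i => (h ≫ G.piece i) ≫ G.sec i) h := by
  have := isJoin_range_comp h G.isJoin_restr_piece
  simpa [Category.assoc, G.piece_sec] using this

lemma isJoin_piece_sec_comp {D : C} (k : E ⟶ D) :
    IsJoin (Set.range fun i => G.piece i ≫ G.sec i ≫ k) k := by
  have := isJoin_range_postcomp G.isJoin_restr_piece k
  simpa [← G.piece_sec] using this

/-- The sheets cover `E`, so a map into `E` is the join of its parts in the individual sheets. -/
lemma hom_ext_piece {T : C} {h k : T ⟶ E} (H : ∀ i, h ≫ G.piece i = k ≫ G.piece i) : h = k := by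
  have h₁ := G.isJoin_comp_piece_sec h
  simp only [H] at h₁
  exact h₁.unique (G.isJoin_comp_piece_sec k)

lemma hom_ext_sec {D : C} {h k : E ⟶ D} (H : ∀ i, G.sec i ≫ h = G.sec i ≫ k) : h = k := by
  have h₁ := G.isJoin_piece_sec_comp h
  simp only [H] at h₁
  exact h₁.unique (G.isJoin_piece_sec_comp k)

/-- A matching family of maps on the charts of a glueing descends to the glued object. -/
lemma exists_desc {D : C} (k : I → (X ⟶ D)) (hk : ∀ i j, φ i j ≫ k i = φ i j ≫ k j)
    (hk' : ∀ i, φ i i ≫ k i = k i) : ∃ h : E ⟶ D, ∀ i, G.sec i ≫ h = k i := by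
  have hc : PairwiseCompat (Set.range fun i => G.piece i ≫ k i) := by
    rintro _ ⟨i, rfl⟩ _ ⟨j, rfl⟩
    refine compat_of_restr_comp_eq (a := G.piece i) (b := G.piece j)
      (by rw [← Category.assoc, restr_comp]) (by rw [← Category.assoc, restr_comp]) ?_
    have h₁ : restr (G.piece j) ≫ G.piece i ≫ k i = G.piece j ≫ φ j i ≫ k i := by
      rw [← Category.assoc, G.restr_piece_comp_piece, Category.assoc]
    have h₂ : restr (G.piece i) ≫ G.piece j ≫ k j = restr (G.piece j) ≫ G.piece i ≫ k j := by
      have : Compat (G.piece j) (G.piece i) :=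
        PairwiseCompat.of_le G.isJoin.1 _ ⟨j, rfl⟩ _ ⟨i, rfl⟩
      rw [← Category.assoc, ← Category.assoc, show _ = _ from this]
    rw [h₁, h₂, ← Category.assoc (restr _), G.restr_piece_comp_piece, Category.assoc, hk]
  obtain ⟨h, hh⟩ := exists_isJoin _ hc
  refine ⟨h, fun i => ?_⟩
  have h₁ := isJoin_range_comp (G.sec i) hh
  -- The `j`-th term is `φ i j ≫ k i`, a restriction of `k i`. The `i`-th term is `k i` itself by
  -- `hk'`, so the join is attained there.
  refine h₁.unique ⟨?_, fun l hl => hl _ ⟨i, ?_⟩⟩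
  · rintro _ ⟨j, rfl⟩
    change HomLE (G.sec i ≫ G.piece j ≫ k j) _
    rw [← Category.assoc, G.sec_piece, ← hk, ← G.restr_eq]
    exact HomLE.of_restr_comp _ _
  · simp only [← Category.assoc, G.sec_piece, hk']

end Glueing

/-! ### Pulling back a glueing along a total map -/

namespace Glueing

variable {X E : C} {I : Type w} {φ : I → I → (X ⟶ X)} {p : E ⟶ X} (G : Glueing φ p)
include G

/-- The transition maps `sec i ≫ piece j` and `sec j ≫ piece i` are mutually partial inverse, being
composites of partial inverses. -/
lemma comp_comp_symm (i j : I) : φ i j ≫ φ j i = φ i j := by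
  have := (G.isPartialInverse i).symm.comp_aux (G.isPartialInverse j)
  rwa [G.sec_piece, G.sec_piece, G.restr_eq] at this

/-- A matrix of maps having a glueing is a local atlas. -/
lemma isLocalAtlas : IsLocalAtlas φ where
  isRestrIdem := G.restr_eq
  symm i j := by
    rw [← G.comp_comp_symm i j, ← G.restr_eq i j, ← G.restr_eq j i, restr_comm, G.restr_eq,
      G.restr_eq, G.comp_comp_symm]
  trans i j k := by
    have h : φ i j ≫ φ j k = φ i j ≫ G.sec i ≫ G.piece k := by
      rw [← Category.assoc, G.comp_sec, Category.assoc, G.sec_piece]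
    rw [h, G.sec_piece, ← G.restr_eq i j]
    exact HomLE.of_restr_comp _ _

/-- The reindexing of the atlas of a glueing along a map. -/
lemma isLocalAtlas_restr_comp {Y : C} (f : Y ⟶ X) :
    IsLocalAtlas fun i j => restr (f ≫ φ i j) where
  isRestrIdem i j := restr_restr _
  symm i j := by rw [G.isLocalAtlas.symm]
  trans i j k := by
    have h : restr (f ≫ φ i j) ≫ restr (f ≫ φ j k) = restr (f ≫ φ i j ≫ φ j k) := by
      rw [← restr_restr_comp, ← Category.assoc, ← comp_restr, G.restr_eq, Category.assoc]
    rw [h]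
    exact ((HomLE.refl f).comp (G.isLocalAtlas.trans i j k)).restr_mono

lemma restr_comp_comp {Y : C} (f : Y ⟶ X) (i j : I) : restr (f ≫ φ i j) ≫ f = f ≫ φ i j := by
  rw [← comp_restr, G.restr_eq]

section Pullback

variable {Y Q : C} {f : Y ⟶ X} {q : Q ⟶ Y} (K : Glueing (fun i j => restr (f ≫ φ i j)) q)
  {g : Q ⟶ E} (hg : ∀ i, K.sec i ≫ g = f ≫ G.sec i)

include K hg

lemma comp_eq_of_sec_comp : g ≫ p = q ≫ f := by
  refine K.hom_ext_sec fun i => ?_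
  rw [← Category.assoc, hg, Category.assoc, G.sec_comp, ← Category.assoc, K.sec_comp,
    G.restr_comp_comp]

lemma comp_piece_of_sec_comp (i : I) : g ≫ G.piece i = K.piece i ≫ f := by
  refine K.hom_ext_sec fun j => ?_
  rw [← Category.assoc, hg, Category.assoc, G.sec_piece, ← Category.assoc, K.sec_piece,
    G.restr_comp_comp]

/-- Where `a` runs in the `i`-th sheet of `E`, its lift has to run in the `i`-th sheet of `Q` above
`b`. The lift is therefore the join of these prescribed parts. -/
lemma exists_lift_of_sec_comp {T : C} {a : T ⟶ E} {b : T ⟶ Y} (hf : IsTotal f)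
    (h : a ≫ p = b ≫ f) : ∃ l : T ⟶ Q, l ≫ g = a ∧ l ≫ q = b := by
  -- Inside the `i`-th sheet, `a` meets the `j`-th sheet exactly where its base point `b ≫ f` lies
  -- in `φ i j`.
  have hover : ∀ i j, restr (a ≫ G.piece i) ≫ restr (a ≫ G.piece j) =
      restr (a ≫ G.piece i) ≫ restr (b ≫ f ≫ φ i j) := by
    intro i j
    have h₁ : restr (a ≫ G.piece i) ≫ a ≫ p = a ≫ G.piece i := by
      rw [← Category.assoc, ← comp_restr, Category.assoc, G.restr_piece_comp]
    rw [← restr_restr_comp, ← restr_restr_comp]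
    congr 1
    rw [← Category.assoc b, ← h, ← Category.assoc, ← comp_restr, Category.assoc,
      G.restr_piece_comp_piece, ← Category.assoc, ← h₁, Category.assoc, h₁, Category.assoc]
  have hpull : ∀ i j, restr (b ≫ f ≫ φ i j) ≫ b ≫ K.sec i =
      restr (b ≫ f ≫ φ i j) ≫ b ≫ K.sec j := by
    intro i j
    have h₁ : restr (b ≫ f ≫ φ i j) ≫ b = b ≫ restr (f ≫ φ i j) := (comp_restr _ _).symm
    rw [← Category.assoc, h₁, Category.assoc, K.comp_sec i j, ← Category.assoc, ← h₁,
      Category.assoc]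
  have hc : PairwiseCompat (Set.range fun i => restr (a ≫ G.piece i) ≫ b ≫ K.sec i) := by
    rintro _ ⟨i, rfl⟩ _ ⟨j, rfl⟩
    refine compat_of_restr_comp_eq (a := a ≫ G.piece i) (b := a ≫ G.piece j)
      (by rw [← Category.assoc, restr_idem]) (by rw [← Category.assoc, restr_idem]) ?_
    rw [← Category.assoc, restr_comm, hover, Category.assoc, hpull, ← Category.assoc, ← hover,
      Category.assoc]
  obtain ⟨l, hl⟩ := exists_isJoin _ hc
  have hdiag : ∀ i, restr (a ≫ G.piece i) ≫ b ≫ K.sec i ≫ q = restr (a ≫ G.piece i) ≫ b := by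
    intro i
    rw [K.sec_comp, comp_restr, ← Category.assoc, ← hover, restr_idem]
  refine ⟨l, ?_, ?_⟩
  · refine (isJoin_range_postcomp hl g).unique ?_
    have := isJoin_range_comp a G.isJoin_restr_piece
    rw [Category.comp_id] at this
    convert this using 3 with i
    rw [Category.assoc, Category.assoc, hg, ← Category.assoc b, ← h, ← Category.assoc,
      ← Category.assoc, ← comp_restr, Category.assoc a, G.restr_piece_comp, Category.assoc,
      G.piece_sec]
  · refine (isJoin_range_postcomp hl q).unique ?_
    have := isJoin_range_postcomp (isJoin_range_restr (isJoin_range_comp a G.isJoin)) b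
    rw [h, hf.restr_comp_eq, restr_comp] at this
    convert this using 3 with i
    rw [Category.assoc, Category.assoc, hdiag]

lemma isPullback_of_sec_comp (hf : IsTotal f) : IsPullback g q p f := by
  refine ⟨⟨G.comp_eq_of_sec_comp K hg⟩, ⟨PullbackCone.IsLimit.mk _
    (fun s => (G.exists_lift_of_sec_comp K hg hf s.condition).choose)
    (fun s => (G.exists_lift_of_sec_comp K hg hf s.condition).choose_spec.1)
    (fun s => (G.exists_lift_of_sec_comp K hg hf s.condition).choose_spec.2) ?_⟩⟩
  intro s m h₁ h₂
  have hl := (G.exists_lift_of_sec_comp K hg hf s.condition).choose_spec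
  set l := (G.exists_lift_of_sec_comp K hg hf s.condition).choose
  -- The part of a map in each sheet of `Q` is computed from its two projections, which gives
  -- uniqueness.
  have key : ∀ (n : s.pt ⟶ Q) i, n ≫ K.piece i = restr ((n ≫ g) ≫ G.piece i) ≫ n ≫ q := by
    intro n i
    rw [Category.assoc, G.comp_piece_of_sec_comp K hg, ← Category.assoc n, hf.restr_comp_eq,
      ← Category.assoc, ← comp_restr, Category.assoc, K.restr_piece_comp]
  refine K.hom_ext_piece fun i => ?_
  rw [key m, key l, h₁, h₂, hl.1, hl.2]

/-- Sheet by sheet, `g` is `f` between two partial isomorphisms. Totality follows from `g ≫ p = q ≫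
f`. -/
lemma isLocalHomeo_of_sec_comp (hf : IsLocalHomeo f) : IsLocalHomeo g := by
  constructor
  · refine isTotal_of_comp (g := p) ?_
    rw [G.comp_eq_of_sec_comp K hg]
    exact K.isTotal.comp hf.1
  · refine IsEtale.of_isJoin ?_ (K.isJoin_piece_sec_comp g)
    rintro _ ⟨i, rfl⟩
    simp only [hg]
    exact IsEtale.comp_partialIso hf.2 ⟨_, K.isPartialInverse i⟩ ⟨_, (G.isPartialInverse i).symm⟩

end Pullback

end Glueing

/-- Glued local homeomorphisms have pullbacks along total maps. -/
lemma Glueing.exists_isPullback [HasLocalGlueings C] {X E Y : C} {I : Type v}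
    {φ : I → I → (X ⟶ X)} {p : E ⟶ X} (G : Glueing φ p) (f : Y ⟶ X) (hf : IsTotal f) :
    ∃ (Q : C) (g : Q ⟶ E) (q : Q ⟶ Y), IsPullback g q p f ∧ IsLocalHomeo q ∧
      (IsLocalHomeo f → IsLocalHomeo g) := by
  obtain ⟨Q, q, ⟨K⟩⟩ := HasLocalGlueings.exists_glueing Y I _ (G.isLocalAtlas_restr_comp f)
  obtain ⟨g, hg⟩ := K.exists_desc (fun i => f ≫ G.sec i)
    (fun i j => by
      rw [← Category.assoc, ← Category.assoc, G.restr_comp_comp, Category.assoc, Category.assoc,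
        G.comp_sec])
    (fun i => by
      rw [← Category.assoc, G.restr_comp_comp, Category.assoc, G.diag_comp_sec])
  exact ⟨Q, g, q, G.isPullback_of_sec_comp K hg hf, K.isLocalHomeo,
    G.isLocalHomeo_of_sec_comp K hg⟩

/-! ### Agreement idempotents and the atlas of germs -/

/-- The restriction idempotents on which `f` and `g` are both defined and agree. -/
def agreeSet {A B : C} (f g : A ⟶ B) : Set (A ⟶ A) :=
  {d | restr d = d ∧ d ≫ restr f = d ∧ d ≫ restr g = d ∧ d ≫ f = d ≫ g}

/-- The join of the restriction idempotents on which two maps agree is itself one of them. -/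
lemma mem_agreeSet_of_isJoin {A B : C} {f g : A ⟶ B} {e : A ⟶ A} (he : IsJoin (agreeSet f g) e) :
    e ∈ agreeSet f g := by
  have hres : restr e = e := by
    refine HomLE.restr_eq_self (f := 𝟙 A) (he.2 _ fun d hd => ?_)
    unfold HomLE
    rw [restr_id, hd.1, Category.comp_id]
  -- Equations between composites with each `d` pass to the join, because postcomposition preserves
  -- joins.
  have heq : ∀ {D : C} (h h' : A ⟶ D),
      (∀ d ∈ agreeSet f g, d ≫ h = d ≫ h') → e ≫ h = e ≫ h' := fun h h' H => by
    refine (isJoin_postcomp he h).unique ?_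
    rw [Set.image_congr H]
    exact isJoin_postcomp he h'
  refine ⟨hres, ?_, ?_, heq f g fun d hd => hd.2.2.2⟩
  · simpa using heq (restr f) (𝟙 A) fun d hd => by rw [hd.2.1, Category.comp_id]
  · simpa using heq (restr g) (𝟙 A) fun d hd => by rw [hd.2.2.1, Category.comp_id]

lemma agreeSet_symm {A B : C} (f g : A ⟶ B) : agreeSet f g = agreeSet g f :=
  Set.ext fun _ => ⟨fun h => ⟨h.1, h.2.2.1, h.2.1, h.2.2.2.symm⟩,
    fun h => ⟨h.1, h.2.2.1, h.2.1, h.2.2.2.symm⟩⟩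

/-- Agreement is transitive: on `φ i j ≫ φ j k` the maps `F i` and `F k` both agree with `F j`, so
this idempotent belongs to the set whose join is `φ i k`. -/
lemma isLocalAtlas_of_isJoin_agreeSet {A B : C} {I : Type w} {F : I → (A ⟶ B)}
    {φ : I → I → (A ⟶ A)} (hφ : ∀ i j, IsJoin (agreeSet (F i) (F j)) (φ i j)) :
    IsLocalAtlas φ where
  isRestrIdem i j := (mem_agreeSet_of_isJoin (hφ i j)).1
  symm i j := (hφ i j).unique (by rw [agreeSet_symm]; exact hφ j i)
  trans i j k := by
    obtain ⟨h₁, h₂, -, h₃⟩ := mem_agreeSet_of_isJoin (hφ i j)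
    obtain ⟨h₁', -, h₂', h₃'⟩ := mem_agreeSet_of_isJoin (hφ j k)
    have hc : φ i j ≫ φ j k = φ j k ≫ φ i j := by
      rw [← h₁, ← h₁', restr_comm]
    refine (hφ i k).1 _ ⟨?_, ?_, ?_, ?_⟩
    · conv_lhs => rw [← h₁, restr_restr_comp, h₁, h₁']
    · rw [hc, Category.assoc, h₂]
    · rw [Category.assoc, h₂']
    · rw [hc, Category.assoc, h₃, ← Category.assoc, ← hc, Category.assoc, h₃', Category.assoc]

lemma isJoin_agreeSet_self {A B : C} {f : A ⟶ B} {e : A ⟶ A} (he : IsJoin (agreeSet f f) e) :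
    e = restr f := by
  obtain ⟨h₁, h₂, -, -⟩ := mem_agreeSet_of_isJoin he
  refine HomLE.antisymm ?_ (he.1 _ ⟨restr_restr f, restr_idem f, restr_idem f, rfl⟩)
  unfold HomLE
  rw [h₁, h₂]

/-- Restriction idempotents are partial isomorphisms, so no idempotent is lost in `PIso C` and
agreement may be computed in `C`. -/
lemma isJoin_eqIdem {A B : C} (f g : (⟨A⟩ : PIso C) ⟶ ⟨B⟩) :
    IsJoin (A := A) (agreeSet f.hom g.hom) (eqIdem (pisoInclusion C) f g) := by
  have hS : eqIdemSet (pisoInclusion C) f g = agreeSet (A := A) f.hom g.hom := by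
    ext d
    constructor
    · rintro ⟨e, he, hle, hfg, rfl⟩
      have key : ∀ (e : A ⟶ A) (f g : A ⟶ B), restr e = e → e = restr e ≫ restr f ≫ restr g →
          e ≫ f = e ≫ g → e ∈ agreeSet f g := by
        intro e f g he hle h
        rw [he] at hle
        refine ⟨he, ?_, ?_, h⟩
        · conv_lhs => rw [hle]
          conv_rhs => rw [hle]
          simp only [Category.assoc]
          rw [restr_comm g, ← Category.assoc (restr f), restr_idem]
        · conv_lhs => rw [hle]
          conv_rhs => rw [hle]
          simp only [Category.assoc]
          rw [restr_idem]
      exact key e.hom f.hom g.hom (congrArg InducedWideCategory.Hom.hom he)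
        (congrArg InducedWideCategory.Hom.hom hle) (congrArg InducedWideCategory.Hom.hom hfg)
    · rintro ⟨hd, hf, hg, h⟩
      refine ⟨⟨d, hd ▸ isPartialIso_restr d⟩, WideSubcategory.hom_ext _ hd,
        WideSubcategory.hom_ext _ ?_, WideSubcategory.hom_ext _ h, rfl⟩
      have key : ∀ (e : A ⟶ A) (f g : A ⟶ B), restr e = e → e ≫ restr f = e →
          e ≫ restr g = e → e = restr e ≫ restr f ≫ restr g := by
        intro e f g he hf hg
        rw [he, ← Category.assoc, hf, hg]
      exact key d f.hom g.hom hd hf hg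
  exact hS ▸ join_isJoin _ (eqIdemSet_compat (pisoInclusion C) f g)

/-! ### The universal property of the object of germs -/

section SpanOfGerms

variable {A B E : C} {I : Type w} {F : I → (A ⟶ B)} {φ : I → I → (A ⟶ A)} {σ : E ⟶ A} {τ : E ⟶ B}

lemma exists_target (hφ : ∀ i j, IsJoin (agreeSet (F i) (F j)) (φ i j)) (G : Glueing φ σ) :
    ∃ τ : E ⟶ B, ∀ i, G.sec i ≫ τ = F i :=
  G.exists_desc F (fun i j => (mem_agreeSet_of_isJoin (hφ i j)).2.2.2)
    fun i => by rw [isJoin_agreeSet_self (hφ i i), restr_comp]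

lemma piece_comp_eq_restr_comp (G : Glueing φ σ) (hτ : ∀ i, G.sec i ≫ τ = F i) (i : I) :
    G.piece i ≫ F i = restr (G.piece i) ≫ τ := by
  rw [← hτ, ← Category.assoc, G.piece_sec]

/-- The map `τ` is the join of the partial isomorphisms `piece i ≫ F i`. It is total because `piece
i` lands in `φ i i = restr (F i)`, so composing with `F i` does not shrink the domain. -/
lemma isLocalHomeo_target (hφ : ∀ i j, IsJoin (agreeSet (F i) (F j)) (φ i j)) (G : Glueing φ σ)
    (hF : ∀ i, IsPartialIso (F i)) (hτ : ∀ i, G.sec i ≫ τ = F i) : IsLocalHomeo τ := by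
  have hJ := G.isJoin_piece_sec_comp τ
  simp only [hτ] at hJ
  refine ⟨(isJoin_range_restr hJ).unique ?_, _, ?_, hJ⟩
  · convert G.isJoin_restr_piece using 3 with i
    rw [← restr_comp_restr, ← isJoin_agreeSet_self (hφ i i), G.piece_comp_diag]
  · rintro _ ⟨i, rfl⟩
    exact IsPartialIso.comp ⟨_, G.isPartialInverse i⟩ (hF i)

/-- If `F i` and `F j` agree along an étale map, so do the corresponding sections. -/
lemma comp_sec_eq_of_comp_eq (hφ : ∀ i j, IsJoin (agreeSet (F i) (F j)) (φ i j))
    (G : Glueing φ σ) {T : C} {a : T ⟶ A} (ha : IsEtale a) {i j : I}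
    (h : a ≫ F i = a ≫ F j) : a ≫ G.sec i = a ≫ G.sec j := by
  -- A partial inverse `t` transports agreement on `T` to a genuine idempotent of `A`, which then
  -- lies below `φ i j`. An arbitrary `a` offers no such idempotent, hence the étaleness hypothesis.
  have hiso : ∀ s : T ⟶ A, IsPartialIso s → s ≫ F i = s ≫ F j → s ≫ G.sec i = s ≫ G.sec j := by
    rintro s ⟨t, hst, hts⟩ hs
    -- the part of the image of `s` on which both maps are defined
    have hti : restr (t ≫ s ≫ F i) = restr t ≫ restr (F i) := by
      rw [← Category.assoc, hts, restr_restr_comp]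
    have htj : restr (t ≫ s ≫ F i) = restr t ≫ restr (F j) := by
      rw [hs, ← Category.assoc, hts, restr_restr_comp]
    have hd : restr (t ≫ s ≫ F i) ∈ agreeSet (F i) (F j) := by
      refine ⟨restr_restr _, ?_, ?_, ?_⟩
      · rw [hti, Category.assoc, restr_idem]
      · rw [htj, Category.assoc, restr_idem]
      · conv_lhs => rw [hti]
        conv_rhs => rw [htj]
        rw [Category.assoc, Category.assoc, restr_comp, restr_comp, ← hts, Category.assoc,
          Category.assoc, hs]
    have hle : restr (t ≫ s ≫ F i) ≫ φ i j = restr (t ≫ s ≫ F i) := by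
      have := ((hφ i j).1 _ hd).restr_comp_eq
      rwa [restr_restr] at this
    have hst' : s ≫ restr t = s := by rw [← hts, ← Category.assoc, hst, restr_comp]
    have hi : s ≫ G.sec i = s ≫ restr (t ≫ s ≫ F i) ≫ G.sec i := by
      rw [hti, Category.assoc, ← Category.assoc s, hst', ← isJoin_agreeSet_self (hφ i i),
        G.diag_comp_sec]
    have hj : s ≫ G.sec j = s ≫ restr (t ≫ s ≫ F i) ≫ G.sec j := by
      rw [htj, Category.assoc, ← Category.assoc s, hst', ← isJoin_agreeSet_self (hφ j j),
        G.diag_comp_sec]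
    rw [hi, hj, ← hle, Category.assoc, G.comp_sec, Category.assoc]
  obtain ⟨S, hS, hSa⟩ := ha
  refine (isJoin_postcomp hSa (G.sec i)).unique ?_
  rw [Set.image_congr (g := fun s => s ≫ G.sec j) fun s hs => hiso s (hS s hs) ?_]
  · exact isJoin_postcomp hSa (G.sec j)
  · rw [← (hSa.1 s hs).restr_comp_eq, Category.assoc, h, Category.assoc]

/-- Maps into the object of germs are determined by their source and target, if the former is
étale. -/
lemma eq_of_comp_source_eq_of_comp_target_eq
    (hφ : ∀ i j, IsJoin (agreeSet (F i) (F j)) (φ i j)) (G : Glueing φ σ)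
    (hτ : ∀ i, G.sec i ≫ τ = F i) {T : C} {h k : T ⟶ E} (hk : IsEtale (k ≫ σ))
    (h₁ : h ≫ σ = k ≫ σ) (h₂ : h ≫ τ = k ≫ τ) : h = k := by
  have hpiece : ∀ (l : T ⟶ E), l ≫ σ = k ≫ σ → ∀ i,
      l ≫ G.piece i = restr (l ≫ G.piece i) ≫ k ≫ σ := by
    intro l hl i
    rw [← hl, ← Category.assoc, ← comp_restr, Category.assoc, G.restr_piece_comp]
  have hF : ∀ (l : T ⟶ E) i, (l ≫ G.piece i) ≫ F i = restr (l ≫ G.piece i) ≫ l ≫ τ := by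
    intro l i
    rw [Category.assoc, piece_comp_eq_restr_comp G hτ, ← Category.assoc, comp_restr,
      Category.assoc]
  -- Where `h` is in sheet `i` and `k` in sheet `j`, both lie over the same restriction of the étale
  -- map `k ≫ σ`. Equality of targets says that `F i` and `F j` agree along it.
  have key : ∀ i j, restr (k ≫ G.piece j) ≫ (h ≫ G.piece i) ≫ G.sec i =
      restr (h ≫ G.piece i) ≫ (k ≫ G.piece j) ≫ G.sec j := by
    intro i j
    have hi : restr (k ≫ G.piece j) ≫ h ≫ G.piece i =
        restr (k ≫ G.piece j) ≫ restr (h ≫ G.piece i) ≫ k ≫ σ := by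
      rw [← hpiece h h₁ i]
    have hj : restr (h ≫ G.piece i) ≫ k ≫ G.piece j =
        restr (k ≫ G.piece j) ≫ restr (h ≫ G.piece i) ≫ k ≫ σ := by
      conv_lhs => rw [hpiece k rfl j]
      rw [← Category.assoc, restr_comm, Category.assoc]
    have he : IsEtale (restr (k ≫ G.piece j) ≫ restr (h ≫ G.piece i) ≫ k ≫ σ) :=
      IsEtale.restr_comp (IsEtale.restr_comp hk _) _
    have := comp_sec_eq_of_comp_eq hφ G (i := i) (j := j) he (by
      conv_lhs => rw [← hi]
      conv_rhs => rw [← hj]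
      rw [Category.assoc, hF, Category.assoc, hF, h₂, ← Category.assoc, restr_comm,
        Category.assoc])
    rw [← Category.assoc, hi, this, ← hj, Category.assoc]
  have hres : ∀ (l : T ⟶ E) i, restr ((l ≫ G.piece i) ≫ G.sec i) = restr (l ≫ G.piece i) := by
    intro l i
    rw [← restr_comp_restr, G.restr_sec, Category.assoc, G.piece_comp_diag]
  have hrestr : restr h = restr k := by
    rw [← G.isTotal.restr_comp_eq h, h₁, G.isTotal.restr_comp_eq]
  -- Both maps are refined over pairs of sheets. The primed version swaps the pair so that `key`
  -- matches the terms.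
  have hh := isJoin_range_restr_comp₂ (G.isJoin_comp_piece_sec h) (G.isJoin_comp_piece_sec k)
  have hk := isJoin_range_restr_comp₂' (G.isJoin_comp_piece_sec k) (G.isJoin_comp_piece_sec h)
  rw [← hrestr, restr_comp] at hh
  rw [hrestr, restr_comp] at hk
  simp only [hres, key] at hh
  simp only [hres] at hk
  exact hh.unique hk

/-- Every span of local homeomorphisms factors through the object of germs. -/
lemma exists_comp_source_eq_comp_target_eq
    (hφ : ∀ i j, IsJoin (agreeSet (F i) (F j)) (φ i j)) (G : Glueing φ σ)
    (hτ : ∀ i, G.sec i ≫ τ = F i) (hF : ∀ f : A ⟶ B, IsPartialIso f → ∃ i, F i = f) {T : C}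
    {a : T ⟶ A} {b : T ⟶ B} (ha : IsLocalHomeo a) (hb : IsLocalHomeo b) :
    ∃ h : T ⟶ E, IsLocalHomeo h ∧ h ≫ σ = a ∧ h ≫ τ = b := by
  obtain ⟨hat, S, hS, hSa⟩ := ha
  obtain ⟨hbt, S', hS', hSb⟩ := hb
  choose inv hinv using fun x : S => hS x x.2
  -- On the pair `k`, the span is the graph of the partial isomorphism `inv k.1 ≫ k.2`; `idx k`
  -- names its sheet.
  choose idx hidx using fun k : S × S' =>
    hF _ (IsPartialIso.comp ⟨_, (hinv k.1).symm⟩ (hS' _ k.2.2))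
  set m : S × S' → (T ⟶ E) := fun k => k.1.1 ≫ G.sec (idx k) with hm
  have hxF : ∀ k, k.1.1 ≫ F (idx k) = restr k.1.1 ≫ k.2.1 := fun k => by
    rw [hidx, ← Category.assoc, (hinv k.1).1]
  have hr : ∀ k, restr (m k) = restr (k.1.1 ≫ F (idx k)) := fun k => by
    rw [hm, ← restr_comp_restr, G.restr_sec, isJoin_agreeSet_self (hφ _ _), restr_comp_restr]
  have hr' : ∀ k, restr (m k) = restr k.1.1 ≫ restr k.2.1 := fun k => by
    rw [hr, hxF, restr_restr_comp]
  have hra : ∀ k, restr (m k) ≫ k.1.1 = restr (m k) ≫ a := fun k => by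
    have h : restr (m k) ≫ restr k.1.1 = restr (m k) := restr_comp_le _ _
    conv_lhs => rw [← (hSa.1 _ k.1.2).restr_comp_eq, ← Category.assoc, h]
  have hrb : ∀ k, restr (m k) ≫ a ≫ F (idx k) = restr (m k) ≫ b := fun k => by
    have h : restr (m k) ≫ restr k.1.1 = restr (m k) := restr_comp_le _ _
    have h' : restr (m k) ≫ restr k.2.1 = restr (m k) := by
      rw [hr', Category.assoc, restr_idem]
    rw [← Category.assoc, ← hra, Category.assoc, hxF, ← Category.assoc, h]
    conv_lhs => rw [← (hSb.1 _ k.2.2).restr_comp_eq, ← Category.assoc, h']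
  have hmm : ∀ k, m k = restr (m k) ≫ a ≫ G.sec (idx k) := fun k => by
    rw [← Category.assoc, ← hra, Category.assoc]
    exact (restr_comp _).symm
  have hc : PairwiseCompat (Set.range m) := by
    rintro _ ⟨k, rfl⟩ _ ⟨l, rfl⟩
    unfold Compat
    have he : IsEtale (restr (m l) ≫ restr (m k) ≫ a) :=
      IsEtale.restr_comp (IsEtale.restr_comp ⟨S, hS, hSa⟩ _) _
    -- On the overlap both `a ≫ F (idx k)` and `a ≫ F (idx l)` equal `b`, so the two sections agree
    -- along `a`.
    have := comp_sec_eq_of_comp_eq hφ G (i := idx k) (j := idx l) he (by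
      rw [Category.assoc, Category.assoc, hrb, ← Category.assoc, restr_comm, Category.assoc,
        ← hrb l]
      simp only [← Category.assoc, restr_comm (m k)])
    conv_lhs => rw [hmm k]
    conv_rhs => rw [hmm l]
    simp only [Category.assoc] at this
    rw [this, ← Category.assoc, restr_comm, Category.assoc]
  obtain ⟨h, hh⟩ := exists_isJoin _ hc
  have hSa' : IsJoin (Set.range fun x : S => x.1) a := by rwa [Subtype.range_coe]
  have hSb' : IsJoin (Set.range fun x : S' => x.1) b := by rwa [Subtype.range_coe]
  have hσ : h ≫ σ = a := by
    have hJ := isJoin_range_restr_comp₂ hSa' hSb'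
    rw [show restr b = _ from hbt, Category.id_comp] at hJ
    refine IsJoin.unique ?_ hJ
    convert isJoin_range_postcomp hh σ using 3 with k
    rw [hm, Category.assoc, G.sec_comp, isJoin_agreeSet_self (hφ _ _), comp_restr, ← hr, hr',
      restr_comm, Category.assoc, restr_comp]
  have hτ' : h ≫ τ = b := by
    have hJ := isJoin_range_restr_comp₂' hSb' hSa'
    rw [show restr a = _ from hat, Category.id_comp] at hJ
    refine IsJoin.unique ?_ hJ
    convert isJoin_range_postcomp hh τ using 3 with k
    rw [hm, Category.assoc, hτ, hxF]
  refine ⟨h, ⟨isTotal_of_comp (g := σ) (by rwa [hσ]), _, ?_, hh⟩, hσ, hτ'⟩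
  rintro _ ⟨k, rfl⟩
  exact (hS _ k.1.2).comp ⟨_, (G.isPartialInverse _).symm⟩

end SpanOfGerms

/-! ### The product property for germs of partial isomorphisms -/

lemma isLocalAtlas_eqIdem (i j : PIso C) :
    IsLocalAtlas fun f g : i ⟶ j => eqIdem (pisoInclusion C) f g :=
  isLocalAtlas_of_isJoin_agreeSet (A := i.obj) (B := j.obj) (F := fun f => f.hom) isJoin_eqIdem

section

variable {i j : PIso C} {E : C} {σ : E ⟶ i.obj} {τ : E ⟶ j.obj}
  (G : Glueing (fun f g : i ⟶ j => eqIdem (pisoInclusion C) f g) σ)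
  (hτ : ∀ f : i ⟶ j, G.sec f ≫ τ = f.hom)

include hτ

lemma isLocalHomeo_haefliger_target : IsLocalHomeo τ :=
  isLocalHomeo_target (A := i.obj) (B := j.obj) (F := fun f : i ⟶ j => f.hom) isJoin_eqIdem G
    (fun f => f.property) hτ

lemma haefliger_hom_ext {T : C} {h k : T ⟶ E} (hk : IsEtale (k ≫ σ)) (h₁ : h ≫ σ = k ≫ σ)
    (h₂ : h ≫ τ = k ≫ τ) : h = k :=
  eq_of_comp_source_eq_of_comp_target_eq (F := fun f => f.hom) isJoin_eqIdem G hτ hk h₁ h₂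

lemma exists_haefliger_lift {T : C} {a : T ⟶ i.obj} {b : T ⟶ j.obj} (ha : IsLocalHomeo a)
    (hb : IsLocalHomeo b) : ∃ h : T ⟶ E, IsLocalHomeo h ∧ h ≫ σ = a ∧ h ≫ τ = b :=
  exists_comp_source_eq_comp_target_eq (F := fun f => f.hom) isJoin_eqIdem G hτ
    (fun f hf => ⟨⟨f, hf⟩, rfl⟩) ha hb

/-- The source-target span of the Haefliger groupoid is a product in local homeomorphisms. -/
lemma nonempty_isLimit_haefliger_span (hσ : IsLocalHomeo σ) (hτ' : IsLocalHomeo τ) :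
    Nonempty (IsLimit (BinaryFan.mk (Lh.homMk σ hσ) (Lh.homMk τ hτ'))) := by
  have hex : ∀ s : BinaryFan (⟨i.obj⟩ : Lh C) ⟨j.obj⟩, ∃ h : s.pt.obj ⟶ E, IsLocalHomeo h ∧
      h ≫ σ = s.fst.hom ∧ h ≫ τ = s.snd.hom := fun s =>
    exists_haefliger_lift G hτ s.fst.property s.snd.property
  choose l hl hlσ hlτ using hex
  refine ⟨BinaryFan.IsLimit.mk _ (fun {T} f g => ⟨l (BinaryFan.mk f g), hl _⟩) ?_ ?_ ?_⟩
  · intro T f g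
    exact WideSubcategory.hom_ext _ (hlσ (BinaryFan.mk f g))
  · intro T f g
    exact WideSubcategory.hom_ext _ (hlτ (BinaryFan.mk f g))
  · intro T f g m hf hg
    refine WideSubcategory.hom_ext _ (haefliger_hom_ext G hτ ?_ ?_ ?_)
    · rw [hlσ]
      exact f.property.2
    · rw [hlσ]
      exact congrArg InducedWideCategory.Hom.hom hf
    · rw [hlτ]
      exact congrArg InducedWideCategory.Hom.hom hg

end

/-! ### Construction of the Haefliger groupoid -/

/-- A partite internal groupoid from a family of spans of local homeomorphisms into which maps
are determined by their source and target, as soon as the source of the map is étale. -/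
def partiteInternalGroupoidOfSpans {I : Type w} {obj : I → C} {E : I → I → C}
    {σ : ∀ i j, E i j ⟶ obj i} {τ : ∀ i j, E i j ⟶ obj j} (hσ' : ∀ i j, IsLocalHomeo (σ i j))
    (hτ' : ∀ i j, IsLocalHomeo (τ i j))
    (ext : ∀ i j {T : C} {h k : T ⟶ E i j}, IsEtale (k ≫ σ i j) → h ≫ σ i j = k ≫ σ i j →
      h ≫ τ i j = k ≫ τ i j → h = k)
    (hpb : ∀ i j {Y : C} (f : Y ⟶ obj i), IsTotal f → ∃ (Q : C) (g : Q ⟶ E i j) (q : Q ⟶ Y),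
      IsPullback g q (σ i j) f ∧ IsLocalHomeo q)
    {η : ∀ i, obj i ⟶ E i i} (hησ : ∀ i, η i ≫ σ i i = 𝟙 (obj i))
    (hητ : ∀ i, η i ≫ τ i i = 𝟙 (obj i)) {P : I → I → I → C} {π₁ : ∀ i j k, P i j k ⟶ E j k}
    {π₂ : ∀ i j k, P i j k ⟶ E i j}
    (hP : ∀ i j k, IsPullback (π₁ i j k) (π₂ i j k) (σ j k) (τ i j))
    (hπ₁ : ∀ i j k, IsLocalHomeo (π₁ i j k)) (hπ₂ : ∀ i j k, IsLocalHomeo (π₂ i j k))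
    {μ : ∀ i j k, P i j k ⟶ E i k} (hμσ : ∀ i j k, μ i j k ≫ σ i k = π₂ i j k ≫ σ i j)
    (hμτ : ∀ i j k, μ i j k ≫ τ i k = π₁ i j k ≫ τ j k) {ν : ∀ i j, E i j ⟶ E j i}
    (hνσ : ∀ i j, ν i j ≫ σ j i = τ i j) (hντ : ∀ i j, ν i j ≫ τ j i = σ i j) :
    PartiteInternalGroupoid obj where
  arr := E
  src := σ
  tgt := τ
  src_total := fun i j => (hσ' i j).1
  tgt_total := fun i j => (hτ' i j).1
  src_hasPullback := fun i j X f hf => by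
    obtain ⟨_, _, _, h, -⟩ := hpb i j f hf
    exact h.hasPullback
  ident := η
  ident_src := hησ
  ident_tgt := hητ
  pb := P
  fst := π₁
  snd := π₂
  isPullback := hP
  comp := μ
  comp_src := hμσ
  comp_tgt := hμτ
  comp_ident := fun i j => by
    refine ext i j ?_ ?_ ?_
    · rw [Category.id_comp]
      exact (hσ' i j).2
    · rw [Category.assoc, hμσ, (hP i i j).lift_snd_assoc, Category.assoc, hησ,
        Category.id_comp]
      exact Category.comp_id _
    · rw [Category.assoc, hμτ, (hP i i j).lift_fst_assoc]
  ident_comp := fun i j => by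
    refine ext i j ?_ ?_ ?_
    · rw [Category.id_comp]
      exact (hσ' i j).2
    · rw [Category.assoc, hμσ, (hP i j j).lift_snd_assoc]
    · rw [Category.assoc, hμτ, (hP i j j).lift_fst_assoc, Category.assoc, hητ,
        Category.id_comp]
      exact Category.comp_id _
  assoc := by
    intro i j k l T a b c hab hbc
    -- The test object `T` is arbitrary, so its source map need not be étale and `ext` does not
    -- apply directly. The law is proved on the universal triple `Q`, whose source map is a local
    -- homeomorphism, and then precomposed with the classifying map `u`.
    obtain ⟨Q, g, q, hQ, hq⟩ :=
      hpb k l (π₁ i j k ≫ τ j k)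
        (IsTotal.comp (hπ₁ i j k).1 (hτ' j k).1)
    -- both composites agree on the universal composable triple
    have hgq : g ≫ σ k l = (q ≫ π₁ i j k) ≫ τ j k := by rw [hQ.w, Category.assoc]
    have hr₁ : g ≫ σ k l = (q ≫ μ i j k) ≫ τ i k := by rw [hQ.w, Category.assoc, hμτ]
    have hr₂ : ((hP j k l).lift g (q ≫ π₁ i j k) hgq ≫ μ j k l) ≫ σ j l =
        (q ≫ π₂ i j k) ≫ τ i j := by
      rw [Category.assoc, hμσ, (hP j k l).lift_snd_assoc, Category.assoc, (hP i j k).w,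
        Category.assoc]
    have key : (hP i k l).lift g (q ≫ μ i j k) hr₁ ≫ μ i k l =
        (hP i j l).lift ((hP j k l).lift g (q ≫ π₁ i j k) hgq ≫ μ j k l)
          (q ≫ π₂ i j k) hr₂ ≫ μ i j l := by
      have h₁ : ((hP i j l).lift ((hP j k l).lift g (q ≫ π₁ i j k) hgq ≫ μ j k l)
          (q ≫ π₂ i j k) hr₂ ≫ μ i j l) ≫ σ i l = q ≫ π₂ i j k ≫ σ i j := by
        rw [Category.assoc, hμσ, (hP i j l).lift_snd_assoc, Category.assoc]
      refine ext i l ?_ ?_ ?_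
      · rw [h₁]
        exact (IsLocalHomeo.comp hq (IsLocalHomeo.comp (hπ₂ i j k) (hσ' i j))).2
      · rw [h₁, Category.assoc, hμσ, (hP i k l).lift_snd_assoc, Category.assoc, hμσ]
      · rw [Category.assoc, hμτ, (hP i k l).lift_fst_assoc, Category.assoc, hμτ,
          (hP i j l).lift_fst_assoc, Category.assoc, hμτ, (hP j k l).lift_fst_assoc]
    have hu : a ≫ σ k l = (hP i j k).lift b c hbc ≫ π₁ i j k ≫ τ j k := by
      rw [hab, (hP i j k).lift_fst_assoc]
    have hug : hQ.lift a ((hP i j k).lift b c hbc) hu ≫ g = a := hQ.lift_fst _ _ _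
    have huq : hQ.lift a ((hP i j k).lift b c hbc) hu ≫ q = (hP i j k).lift b c hbc :=
      hQ.lift_snd _ _ _
    set u := hQ.lift a ((hP i j k).lift b c hbc) hu
    have hub : u ≫ q ≫ π₁ i j k = b := by
      rw [← Category.assoc, huq, (hP i j k).lift_fst]
    have huc : u ≫ q ≫ π₂ i j k = c := by
      rw [← Category.assoc, huq, (hP i j k).lift_snd]
    have hab' : (hP j k l).lift a b hab = u ≫ (hP j k l).lift g (q ≫ π₁ i j k) hgq :=
      (hP j k l).hom_ext
        (by rw [(hP j k l).lift_fst, Category.assoc, (hP j k l).lift_fst, hug])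
        (by rw [(hP j k l).lift_snd, Category.assoc, (hP j k l).lift_snd, hub])
    have hL := congrArg (u ≫ ·) key
    simp only [← Category.assoc] at hL
    convert hL using 2
    · refine (hP i k l).hom_ext ?_ ?_
      · rw [(hP i k l).lift_fst, Category.assoc, (hP i k l).lift_fst, hug]
      · rw [(hP i k l).lift_snd, Category.assoc, (hP i k l).lift_snd, ← Category.assoc, huq]
    · refine (hP i j l).hom_ext ?_ ?_
      · rw [(hP i j l).lift_fst, Category.assoc, (hP i j l).lift_fst, hab', Category.assoc]
      · rw [(hP i j l).lift_snd, Category.assoc, (hP i j l).lift_snd, huc]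
  inv := ν
  inv_inv := fun i j => by
    refine ext i j ?_ ?_ ?_
    · rw [Category.id_comp]
      exact (hσ' i j).2
    · rw [Category.assoc, hνσ, hντ, Category.id_comp]
    · rw [Category.assoc, hντ, hνσ, Category.id_comp]
  inv_src := hνσ
  inv_comp := fun i j => by
    have h : (σ i j ≫ η i) ≫ σ i i = σ i j := by
      rw [Category.assoc, hησ]
      exact Category.comp_id _
    refine ext i i ?_ ?_ ?_
    · rw [h]
      exact (hσ' i j).2
    · rw [h, Category.assoc, hμσ, (hP i j i).lift_snd_assoc, Category.id_comp]
    · rw [Category.assoc, hμτ, (hP i j i).lift_fst_assoc, hντ, Category.assoc, hητ]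
      exact (Category.comp_id _).symm

variable (C) in
/-- The Haefliger groupoid exists. -/
theorem nonempty_haefligerGroupoid [HasLocalGlueings C] : Nonempty (HaefligerGroupoid C) := by
  choose E σ hG using fun i j : PIso C =>
    HasLocalGlueings.exists_glueing i.obj (i ⟶ j) _ (isLocalAtlas_eqIdem i j)
  let G := fun i j => (hG i j).some
  choose τ hτ using fun i j : PIso C =>
    exists_target (A := i.obj) (B := j.obj) (F := fun f : i ⟶ j => f.hom) isJoin_eqIdem (G i j)
  have hσ' : ∀ i j, IsLocalHomeo (σ i j) := fun i j => (G i j).isLocalHomeo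
  have hτ' : ∀ i j, IsLocalHomeo (τ i j) := fun i j =>
    isLocalHomeo_haefliger_target (G i j) (hτ i j)
  have ext := fun i j => @haefliger_hom_ext C _ _ i j _ _ _ (G i j) (hτ i j)
  choose P π₁ π₂ hP hπ₂ hπ₁ using fun i j k : PIso C =>
    (G j k).exists_isPullback (τ i j) (hτ' i j).1
  replace hπ₁ := fun i j k => hπ₁ i j k (hτ' i j)
  -- Composition is induced by the outer source and target of a composable pair, and inversion below
  -- by the swapped span.
  choose μ _ hμσ hμτ using fun i j k => exists_haefliger_lift (G i k) (hτ i k)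
    (IsLocalHomeo.comp (hπ₂ i j k) (hσ' i j)) (IsLocalHomeo.comp (hπ₁ i j k) (hτ' j k))
  choose ν _ hνσ hντ using fun i j => exists_haefliger_lift (G j i) (hτ j i)
    (hτ' i j) (hσ' i j)
  have hησ : ∀ i, (G i i).sec (𝟙 i) ≫ σ i i = 𝟙 i.obj := fun i => by
    rw [(G i i).sec_comp]
    exact (isJoin_agreeSet_self (isJoin_eqIdem (𝟙 i) (𝟙 i))).trans (restr_id _)
  have hητ : ∀ i, (G i i).sec (𝟙 i) ≫ τ i i = 𝟙 i.obj := fun i => hτ i i (𝟙 i)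
  have hcomp : ∀ (i j k : PIso C) (f : i ⟶ j) (g : j ⟶ k)
      (h : IsPartialSection (σ j k) ((G j k).sec g)),
      (G i j).sec f ≫ pullbackSection (hP i j k) ((G j k).sec g) h ≫ μ i j k =
        (G i k).sec (f ≫ g) := by
    intro i j k f g h
    have hsec : ∀ {i j : PIso C} (f : i ⟶ j), restr ((G i j).sec f) = restr f.hom := fun f => by
      rw [(G _ _).restr_sec]
      exact isJoin_agreeSet_self (isJoin_eqIdem f f)
    have hσ₂ : (G i k).sec (f ≫ g) ≫ σ i k = restr (f ≫ g).hom := by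
      rw [← hsec]
      exact (G i k).isPartialSection _
    unfold pullbackSection
    -- The source component is a restriction idempotent, hence étale, though not total in general.
    -- This is why `ext` asks only for étaleness.
    refine ext i k ?_ ?_ ?_
    · rw [hσ₂]
      exact (isPartialIso_restr _).isEtale
    · rw [hσ₂, Category.assoc, Category.assoc, hμσ, (hP i j k).lift_snd_assoc, ← Category.assoc,
        comp_restr, ← Category.assoc ((G i j).sec f), hτ, Category.assoc,
        show _ = _ from (G i j).isPartialSection f, hsec, ← restr_comp_restr, hsec,
        restr_comp_restr, restr_comp_le]
      rfl
    · rw [hτ, Category.assoc, Category.assoc, hμτ, (hP i j k).lift_fst_assoc, Category.assoc, hτ,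
        ← Category.assoc, hτ]
      rfl
  let 𝔸 : PartiteInternalGroupoid (pisoInclusion C).obj :=
    partiteInternalGroupoidOfSpans (obj := (pisoInclusion C).obj) hσ' hτ' ext
      (fun i j _ f hf => by
        obtain ⟨Q, g, q, hQ, hq, -⟩ := (G i j).exists_isPullback f hf
        exact ⟨Q, g, q, hQ, hq⟩)
      hησ hητ hP hπ₁ hπ₂ hμσ hμτ hνσ hντ
  exact ⟨{ toPartiteInternalGroupoid := 𝔸
           internalisation :=
            { glue := G
              sec_tgt := fun f => hτ _ _ f
              ident_eq := fun i => rfl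
              comp_eq := fun {i j k} f g => hcomp i j k f g _ }}⟩

end JoinRestrictionCategory

theorem mainTheorem9 (C : Type u) [Category.{v} C] [JoinRestrictionCategory C]
    [HasLocalGlueings C] :
    Nonempty (HaefligerGroupoid C) ∧
    ∀ (H : HaefligerGroupoid C) (A B : C),
      ∃ (hσ : IsLocalHomeo (H.source A B)) (hτ : IsLocalHomeo (H.target A B)),
        Nonempty (IsLimit (BinaryFan.mk
          (Lh.homMk (H.source A B) hσ) (Lh.homMk (H.target A B) hτ))) := by
  refine ⟨nonempty_haefligerGroupoid C, fun H A B => ?_⟩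
  -- Only the source glueing and the values of the target on its sections matter, so the conclusion
  -- holds for every choice of glueings and fibre products.
  have hτ : ∀ f : (⟨A⟩ : PIso C) ⟶ ⟨B⟩,
      (H.internalisation.glue ⟨A⟩ ⟨B⟩).sec f ≫ H.tgt ⟨A⟩ ⟨B⟩ = f.hom :=
    H.internalisation.sec_tgt
  exact ⟨(H.internalisation.glue ⟨A⟩ ⟨B⟩).isLocalHomeo, isLocalHomeo_haefliger_target _ hτ,
    nonempty_isLimit_haefliger_span _ hτ _ _⟩
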